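/- **Theorem 5.5.** Let $n\ge 1$ be odd, $t_0<T$, and let $a_0,\dots,a_n$ be real-valued continuous functions on $[t_0,T]$. Consider the equation $$y'+\sum_{k=0}^{n}a_k(t)\,y^k=0,\qquad t\in[t_0,T]. \tag{1.1}$$ Suppose that $a_n(t)\ge 0$ on $[t_0,T]$ and that $a_k(t)=a_n(t)c_k(t)+d_k(t)$ for $t\in[t_0,T]$, $k=2,\dots,n-1$, where the functions $c_k$ are bounded on $[t_0,T]$. Put $$N_T=\max\Bigl\{1,\ \sup_{t\in[t_0,T]}\sum_{k=2}^{n-1}|c_k(t)|\Bigr\},\qquad A(t)=\int_{t_0}^{t}a_1(s)\,ds,\qquad J(t)=\int_{t_0}^{t}e^{A(\tau)}a_0(\tau)\,d\tau .$$ Assume that for all $u\ge N_T$ and $t\in[t_0,T]$ $$\sum_{k=2}^{n-1}d_k(t)u^k\ge 0,\qquad \sum_{k=2}^{n-1}(-1)^{k+1}d_k(t)u^k\ge 0,$$ and that $$\max_{[t_0,T]}J\cdot\bigl[1-e^{A(T)}\bigr]\le J(T)\le \min_{[t_0,T]}J\cdot\bigl[1-e^{A(T)}\bigr].$$ Then (1.1)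 has a closed solution on $[t_0,T]$, that is, a solution $y$ on $[t_0,T]$ with $y(t_0)=y(T)$. Moreover, $y$ can be chosen so that $\zeta(t)\le y(t)\le\eta(t)$ for all $t\in[t_0,T]$, where $$\eta(t)=N_T\,e^{\max_{[t_0,T]}A-A(t)}+e^{-A(t)}\Bigl[\max_{[t_0,T]}J-J(t)\Bigr],\qquad \zeta(t)=-N_T\,e^{\max_{[t_0,T]}A-A(t)}-e^{-A(t)}\Bigl[\max_{[t_0,T]}(-J)+J(t)\Bigr].$$ -/

import Mathlib

open Set

noncomputable section

/-- `y` solves `y' + ∑_{k=0}^n a_k(t) y^k = 0` on `[t₀, T]`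
(one-sided derivatives at the endpoints). -/
def IsPolySolution (n : ℕ) (a : ℕ → ℝ → ℝ) (t₀ T : ℝ) (y : ℝ → ℝ) : Prop :=
  ∀ t ∈ Icc t₀ T,
    HasDerivWithinAt y (-∑ k ∈ Finset.range (n + 1), a k t * y t ^ k) (Icc t₀ T) t

/-- A solution on `[t₀, T]` is closed if it takes equal values at the two endpoints. -/
def IsClosedPolySolution (n : ℕ) (a : ℕ → ℝ → ℝ) (t₀ T : ℝ) (y : ℝ → ℝ) : Prop :=
  IsPolySolution n a t₀ T y ∧ y t₀ = y T

/-- `A(t) = ∫_{t₀}^t a₁(s) ds`. -/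
def linPrim (a : ℕ → ℝ → ℝ) (t₀ t : ℝ) : ℝ :=
  ∫ s in t₀..t, a 1 s

/-- `J(t) = ∫_{t₀}^t exp(∫_{t₀}^τ a₁(s) ds) a₀(τ) dτ`. -/
def forcingPrim (a : ℕ → ℝ → ℝ) (t₀ t : ℝ) : ℝ :=
  ∫ τ in t₀..t, Real.exp (linPrim a t₀ τ) * a 0 τ

/-- Supremum of `f` over `[t₀, T]` (the maximum when `f` is continuous there). -/
def supIcc (f : ℝ → ℝ) (t₀ T : ℝ) : ℝ :=
  sSup (f '' Icc t₀ T)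

/-- Infimum of `f` over `[t₀, T]` (the minimum when `f` is continuous there). -/
def infIcc (f : ℝ → ℝ) (t₀ T : ℝ) : ℝ :=
  sInf (f '' Icc t₀ T)

/-- `N_T = max {1, sup_{t ∈ [t₀, T]} ∑_{k=2}^{n-1} |c_k(t)|}`. -/
def coeffBound (n : ℕ) (c : ℕ → ℝ → ℝ) (t₀ T : ℝ) : ℝ :=
  max 1 (supIcc (fun t => ∑ k ∈ Finset.Icc 2 (n - 1), |c k t|) t₀ T)

/-- Upper barrier
`η_{γ,T}(t) = γ exp(max A - A(t)) + exp(-A(t)) [max J - J(t)]`, maxima over `[t₀, T]`. -/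
def upperBarrier (a : ℕ → ℝ → ℝ) (γ t₀ T t : ℝ) : ℝ :=
  γ * Real.exp (supIcc (linPrim a t₀) t₀ T - linPrim a t₀ t)
    + Real.exp (-linPrim a t₀ t) * (supIcc (forcingPrim a t₀) t₀ T - forcingPrim a t₀ t)

/-- Lower barrier
`ζ_{γ,T}(t) = -γ exp(max A - A(t)) - exp(-A(t)) [max (-J) + J(t)]`, maxima over `[t₀, T]`. -/
def lowerBarrier (a : ℕ → ℝ → ℝ) (γ t₀ T t : ℝ) : ℝ :=
  -γ * Real.exp (supIcc (linPrim a t₀) t₀ T - linPrim a t₀ t)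
    - Real.exp (-linPrim a t₀ t) *
      (supIcc (fun ξ => -forcingPrim a t₀ ξ) t₀ T + forcingPrim a t₀ t)

end

/-! Let `A(T) ≥ 0`. Both barriers have the form `e^{-A}(C - J)`, so they solve the linear equation
`y' + a₁y + a₀ = 0`. Since `η ≥ N_T` and `ζ ≤ -N_T`, the terms of degree at least two have a
definite sign along them (`n` is odd), making `η` an upper and `ζ` a lower solution. The conditions
on `J` give `η(T) ≤ η(t₀)` and `ζ(t₀) ≤ ζ(T)`, so the map `y(t₀) ↦ y(T)` sends `[ζ(t₀), η(t₀)]` into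
itself and has a fixed point (`exists_closed_solution_between`). If `A(T) < 0`, the conditions force
`max J ≤ min J`, hence `J = 0` and `a₀ = 0`, and the zero function is a solution. -/

/-! ### Comparison and ordered lower and upper solutions. -/

/-- Fencing: if `w` has nonpositive right derivative wherever it is positive and starts nonpositive,
it stays nonpositive. -/
theorem nonpos_of_deriv_nonpos_of_pos {t₀ T : ℝ} {w w' : ℝ → ℝ}
    (hw : ∀ t ∈ Icc t₀ T, HasDerivWithinAt w (w' t) (Icc t₀ T) t)
    (h0 : w t₀ ≤ 0) (hpos : ∀ t ∈ Icc t₀ T, 0 < w t → w' t ≤ 0) :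
    ∀ t ∈ Icc t₀ T, w t ≤ 0 := by
  intro t ht
  refine le_of_forall_pos_le_add fun ε hε => ?_
  have hT : 0 < 1 + (T - t₀) := by linarith [ht.1.trans ht.2]
  -- The comparison theorem needs a strict inequality of slopes, so `w` is compared with a positive
  -- line of slope `δ > 0` that reaches `ε` at `T`.
  set δ := ε / (1 + (T - t₀)) with hδ
  have hδ0 : 0 < δ := div_pos hε hT
  have key := image_le_of_deriv_right_lt_deriv_boundary' (f := w) (f' := w') (a := t₀) (b := T)
    (B := fun s => δ * (1 + (s - t₀))) (B' := fun _ => δ)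
    (fun s hs => (hw s hs).continuousWithinAt)
    (fun s hs => (hw s ⟨hs.1, hs.2.le⟩).mono_of_mem_nhdsWithin (Icc_mem_nhdsGE_of_mem hs))
    (by simp only [sub_self, add_zero, mul_one]; linarith)
    (by fun_prop)
    (fun s _ => by
      simpa using ((((hasDerivAt_id s).sub_const t₀).const_add 1).const_mul δ).hasDerivWithinAt)
    (fun s hs hE => by
      have : 0 < δ * (1 + (s - t₀)) := mul_pos hδ0 (by linarith [hs.1])
      exact (hpos s ⟨hs.1, hs.2.le⟩ (by rw [hE]; exact this)).trans_lt hδ0) ht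
  have h2 : δ * (1 + (t - t₀)) ≤ δ * (1 + (T - t₀)) := by
    have := ht.2
    gcongr
  have h3 : δ * (1 + (T - t₀)) = ε := div_mul_cancel₀ _ hT.ne'
  linarith

/-- A scalar equation `y' = f t y` with ordered lower and upper solutions `α ≤ β` satisfying
`α t₀ ≤ α T` and `β T ≤ β t₀` has a closed solution between them. -/
theorem exists_closed_solution_between {t₀ T : ℝ} (hT : t₀ < T) {f : ℝ → ℝ → ℝ}
    {α β α' β' : ℝ → ℝ}
    (hf : ContinuousOn (Function.uncurry f) (Icc t₀ T ×ˢ univ))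
    (hlip : ∀ R : ℝ, ∃ K : NNReal, ∀ t ∈ Icc t₀ T, LipschitzOnWith K (f t) (Icc (-R) R))
    (hα : ∀ t ∈ Icc t₀ T, HasDerivWithinAt α (α' t) (Icc t₀ T) t)
    (hβ : ∀ t ∈ Icc t₀ T, HasDerivWithinAt β (β' t) (Icc t₀ T) t)
    (hα' : ∀ t ∈ Icc t₀ T, α' t ≤ f t (α t))
    (hβ' : ∀ t ∈ Icc t₀ T, f t (β t) ≤ β' t)
    (hαβ : ∀ t ∈ Icc t₀ T, α t ≤ β t)
    (hα0 : α t₀ ≤ α T) (hβ0 : β T ≤ β t₀) :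
    ∃ y : ℝ → ℝ, (∀ t ∈ Icc t₀ T, HasDerivWithinAt y (f t (y t)) (Icc t₀ T) t) ∧
      y t₀ = y T ∧ ∀ t ∈ Icc t₀ T, α t ≤ y t ∧ y t ≤ β t := by
  have hαc : ContinuousOn α (Icc t₀ T) := fun t ht => (hα t ht).continuousWithinAt
  have hβc : ContinuousOn β (Icc t₀ T) := fun t ht => (hβ t ht).continuousWithinAt
  have h0mem : t₀ ∈ Icc t₀ T := ⟨le_rfl, hT.le⟩
  have hTmem : T ∈ Icc t₀ T := ⟨hT.le, le_rfl⟩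
  obtain ⟨Ra, hRa⟩ := isCompact_Icc.exists_bound_of_continuousOn hαc
  obtain ⟨Rb, hRb⟩ := isCompact_Icc.exists_bound_of_continuousOn hβc
  set R := max Ra Rb
  have hαR : ∀ t ∈ Icc t₀ T, |α t| ≤ R := fun t ht => (hRa t ht).trans (le_max_left _ _)
  have hβR : ∀ t ∈ Icc t₀ T, |β t| ≤ R := fun t ht => (hRb t ht).trans (le_max_right _ _)
  have hR : 0 ≤ R := (abs_nonneg _).trans (hαR t₀ h0mem)
  obtain ⟨K, hK⟩ := hlip R
  obtain ⟨M, hM⟩ := (isCompact_Icc.prod (isCompact_Icc (a := -R) (b := R))).exists_bound_of_continuousOn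
    (hf.mono (prod_mono_right (subset_univ _)))
  -- Truncating the field to the strip between `α` and `β` makes it bounded and Lipschitz for all
  -- `x`, so Picard–Lindelöf covers all of `[t₀, T]`. Solutions starting in the strip stay there,
  -- where `g = f`.
  set clamp : ℝ → ℝ → ℝ := fun t x => max (α t) (min x (β t)) with hclamp
  have hcmem : ∀ t ∈ Icc t₀ T, ∀ x, clamp t x ∈ Icc (-R) R := fun t ht x =>
    ⟨(abs_le.1 (hαR t ht)).1.trans (le_max_left _ _),
      max_le (abs_le.1 (hαR t ht)).2 ((min_le_right _ _).trans (abs_le.1 (hβR t ht)).2)⟩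
  have hclip : ∀ t, LipschitzWith 1 (clamp t) := fun t =>
    (LipschitzWith.id.min_const (β t)).const_max (α t)
  set g : ℝ → ℝ → ℝ := fun t x => f t (clamp t x) with hg
  set L : NNReal := Real.toNNReal M
  set r : NNReal := ⟨R, hR⟩
  have hPL : IsPicardLindelof g (⟨t₀, h0mem⟩ : Icc t₀ T) (0 : ℝ)
      (L * Real.toNNReal (T - t₀) + r) r L K := by
    refine ⟨fun t ht => ?_, fun x _ => ?_, fun t ht x _ => ?_, ?_⟩
    · have := (hK t ht).comp ((hclip t).lipschitzOnWith (s := univ)) (fun x _ => hcmem t ht x)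
      rw [mul_one] at this
      exact this.mono (subset_univ _)
    · refine hf.comp (f := fun t => (t, clamp t x)) ?_ fun t ht => ⟨ht, trivial⟩
      exact continuousOn_id.prodMk (hαc.sup (continuousOn_const.inf hβc))
    · exact (hM (t, clamp t x) ⟨ht, hcmem t ht x⟩).trans (Real.le_coe_toNNReal M)
    · have : max (T - t₀) (t₀ - t₀) = T - t₀ := max_eq_left (by linarith)
      rw [this]
      simp [Real.coe_toNNReal _ (sub_nonneg.2 hT.le)]
  obtain ⟨Y, hY, hYc⟩ :=
    hPL.exists_forall_mem_closedBall_eq_hasDerivWithinAt_continuousOn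
  have hball : Icc (α t₀) (β t₀) ⊆ Metric.closedBall (0 : ℝ) r := fun x hx => by
    rw [mem_closedBall_zero_iff, Real.norm_eq_abs]
    exact abs_le.2 ⟨(abs_le.1 (hαR t₀ h0mem)).1.trans hx.1, hx.2.trans (abs_le.1 (hβR t₀ h0mem)).2⟩
  have hup : ∀ x ∈ Icc (α t₀) (β t₀), ∀ t ∈ Icc t₀ T, Y (x, t) ≤ β t := by
    intro x hx t ht
    have := nonpos_of_deriv_nonpos_of_pos (w := fun s => Y (x, s) - β s)
      (fun s hs => ((hY x (hball hx)).2 s hs).sub (hβ s hs))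
      (by have := (hY x (hball hx)).1; simp only at this; simp only [this]; linarith [hx.2])
      (fun s hs hp => by
        -- Above `β` the truncated field is `f s (β s) ≤ β' s`, so `Y - β` cannot grow.
        have h1 : clamp s (Y (x, s)) = β s := by
          simp only [hclamp]
          rw [min_eq_right (by linarith), max_eq_right (hαβ s hs)]
        simp only [hg, h1]
        linarith [hβ' s hs]) t ht
    linarith
  have hlow : ∀ x ∈ Icc (α t₀) (β t₀), ∀ t ∈ Icc t₀ T, α t ≤ Y (x, t) := by
    intro x hx t ht
    have := nonpos_of_deriv_nonpos_of_pos (w := fun s => α s - Y (x, s))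
      (fun s hs => (hα s hs).sub ((hY x (hball hx)).2 s hs))
      (by have := (hY x (hball hx)).1; simp only at this; simp only [this]; linarith [hx.1])
      (fun s hs hp => by
        have h1 : clamp s (Y (x, s)) = α s := by
          simp only [hclamp]
          exact max_eq_left ((min_le_left _ _).trans (by linarith))
        simp only [hg, h1]
        linarith [hα' s hs]) t ht
    linarith
  have hcont : ContinuousOn (fun x => Y (x, T) - x) (Icc (α t₀) (β t₀)) :=
    (hYc.comp (f := fun x => (x, T)) (by fun_prop) fun x hx => ⟨hball hx, hTmem⟩).sub continuousOn_id
  have hab := hαβ t₀ h0mem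
  -- The displacement `Y (x, T) - x` is nonnegative at `α t₀` and nonpositive at `β t₀`.
  obtain ⟨x, hx, hx0⟩ := intermediate_value_Icc' hab hcont
    (show (0 : ℝ) ∈ Icc _ _ from
      ⟨by linarith [hup _ (right_mem_Icc.2 hab) T hTmem],
       by linarith [hlow _ (left_mem_Icc.2 hab) T hTmem]⟩)
  refine ⟨fun t => Y (x, t), fun t ht => ?_, ?_, fun t ht => ⟨hlow x hx t ht, hup x hx t ht⟩⟩
  · have h1 : clamp t (Y (x, t)) = Y (x, t) := by
      simp only [hclamp]
      rw [min_eq_left (hup x hx t ht), max_eq_right (hlow x hx t ht)]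
    have := (hY x (hball hx)).2 t ht
    simp only [hg, h1] at this
    exact this
  · have := (hY x (hball hx)).1
    simp only at this ⊢
    linarith

/-! ### Sign of the higher-degree terms for large arguments. -/

theorem sum_range_succ_eq_add_add_Icc {n : ℕ} (hn : 2 ≤ n) (g : ℕ → ℝ) :
    ∑ k ∈ Finset.range (n + 1), g k = g 0 + g 1 + ∑ k ∈ Finset.Icc 2 (n - 1), g k + g n := by
  have h1 : Finset.Icc 2 (n - 1) = Finset.Ico 2 n := by ext k; simp; omega
  rw [Finset.sum_range_succ, h1, Finset.range_eq_Ico, Finset.sum_eq_sum_Ico_succ_bot (by omega),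
    Finset.sum_eq_sum_Ico_succ_bot (by omega)]
  ring

/-- Above the threshold, the part of degree at least two of the polynomial is nonnegative. -/
theorem affine_le_sum_of_le {n : ℕ} (hn : Odd n) {a c d : ℕ → ℝ} {u : ℝ} (hu : 1 ≤ u)
    (hcu : ∑ k ∈ Finset.Icc 2 (n - 1), |c k| ≤ u) (han : 0 ≤ a n)
    (hdec : ∀ k ∈ Finset.Icc 2 (n - 1), a k = a n * c k + d k)
    (hd : 0 ≤ ∑ k ∈ Finset.Icc 2 (n - 1), d k * u ^ k) :
    a 0 + a 1 * u ≤ ∑ k ∈ Finset.range (n + 1), a k * u ^ k := by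
  obtain rfl | hn2 : n = 1 ∨ 2 ≤ n := by have := hn.pos; omega
  · simp [Finset.sum_range_succ]
  have hu0 : 0 ≤ u := zero_le_one.trans hu
  -- Each `u ^ k` is at most `u ^ (n - 1)`, and `∑ |c k| ≤ u` supplies the last factor; the leading
  -- term `a n * u ^ n` then absorbs `a n * ∑ c k * u ^ k`.
  have hc : -u ^ n ≤ ∑ k ∈ Finset.Icc 2 (n - 1), c k * u ^ k := by
    have h1 : ∑ k ∈ Finset.Icc 2 (n - 1), -(|c k| * u ^ (n - 1)) ≤
        ∑ k ∈ Finset.Icc 2 (n - 1), c k * u ^ k := by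
      refine Finset.sum_le_sum fun k hk => ?_
      have h2 : u ^ k ≤ u ^ (n - 1) := pow_le_pow_right₀ hu (Finset.mem_Icc.1 hk).2
      have h3 : |c k| * u ^ k ≤ |c k| * u ^ (n - 1) := by gcongr
      have h4 : -|c k| * u ^ k ≤ c k * u ^ k := by
        gcongr
        exact neg_abs_le _
      linarith
    rw [Finset.sum_neg_distrib, ← Finset.sum_mul] at h1
    have h5 : (∑ k ∈ Finset.Icc 2 (n - 1), |c k|) * u ^ (n - 1) ≤ u * u ^ (n - 1) := by gcongr
    rw [mul_pow_sub_one (by omega)] at h5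
    linarith
  have hsum : ∑ k ∈ Finset.Icc 2 (n - 1), a k * u ^ k =
      a n * ∑ k ∈ Finset.Icc 2 (n - 1), c k * u ^ k + ∑ k ∈ Finset.Icc 2 (n - 1), d k * u ^ k := by
    rw [Finset.mul_sum, ← Finset.sum_add_distrib]
    exact Finset.sum_congr rfl fun k hk => by rw [hdec k hk]; ring
  rw [sum_range_succ_eq_add_add_Icc hn2, hsum]
  have := mul_le_mul_of_nonneg_left hc han
  simp only [pow_zero, pow_one, mul_one]
  linarith

/-- Reflection `u ↦ -u` turns `a k` into `(-1) ^ (k + 1) * a k` after an overall sign change; as `n`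
is odd, the leading coefficient is unchanged and the previous estimate applies. -/
theorem sum_le_affine_of_le {n : ℕ} (hn : Odd n) {a c d : ℕ → ℝ} {u : ℝ} (hu : 1 ≤ u)
    (hcu : ∑ k ∈ Finset.Icc 2 (n - 1), |c k| ≤ u) (han : 0 ≤ a n)
    (hdec : ∀ k ∈ Finset.Icc 2 (n - 1), a k = a n * c k + d k)
    (hd : 0 ≤ ∑ k ∈ Finset.Icc 2 (n - 1), (-1 : ℝ) ^ (k + 1) * d k * u ^ k) :
    ∑ k ∈ Finset.range (n + 1), a k * (-u) ^ k ≤ a 0 + a 1 * (-u) := by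
  have hn1 : (-1 : ℝ) ^ (n + 1) = 1 := hn.add_one.neg_one_pow
  have key := affine_le_sum_of_le hn (a := fun k => (-1 : ℝ) ^ (k + 1) * a k)
    (c := fun k => (-1 : ℝ) ^ (k + 1) * c k) (d := fun k => (-1 : ℝ) ^ (k + 1) * d k) hu
    (by simpa [abs_mul] using hcu) (by simpa [hn1] using han)
    (fun k hk => by simp only [hdec k hk, hn1]; ring) hd
  have h : ∑ k ∈ Finset.range (n + 1), (-1 : ℝ) ^ (k + 1) * a k * u ^ k =
      -∑ k ∈ Finset.range (n + 1), a k * (-u) ^ k := by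
    rw [← Finset.sum_neg_distrib]
    refine Finset.sum_congr rfl fun k _ => ?_
    rw [neg_pow u, pow_succ]
    ring
  rw [h] at key
  norm_num at key
  linarith

/-! ### Regularity and extrema on the interval. -/

theorem hasDerivWithinAt_integral_Icc {g : ℝ → ℝ} {t₀ T : ℝ} (hg : ContinuousOn g (Icc t₀ T))
    {t : ℝ} (ht : t ∈ Icc t₀ T) :
    HasDerivWithinAt (fun s => ∫ x in t₀..s, g x) (g t) (Icc t₀ T) t := by
  have : Fact (t ∈ Icc t₀ T) := ⟨ht⟩
  exact intervalIntegral.integral_hasDerivWithinAt_right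
    ((hg.mono (Icc_subset_Icc_right ht.2)).intervalIntegrable_of_Icc ht.1)
    (hg.stronglyMeasurableAtFilter_nhdsWithin measurableSet_Icc t) (hg t ht)

/-- A polynomial vector field with continuous coefficients is uniformly Lipschitz on bounded sets. -/
theorem exists_lipschitzOnWith_poly {n : ℕ} {a : ℕ → ℝ → ℝ} {t₀ T : ℝ}
    (ha : ∀ k ≤ n, ContinuousOn (a k) (Icc t₀ T)) (R : ℝ) :
    ∃ K : NNReal, ∀ t ∈ Icc t₀ T, LipschitzOnWith K
      (fun u => -∑ k ∈ Finset.range (n + 1), a k t * u ^ k) (Icc (-R) R) := by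
  have hb : ∀ k, ∃ M : ℝ, k ≤ n → ∀ t ∈ Icc t₀ T, |a k t| ≤ M := fun k => by
    by_cases hk : k ≤ n
    · obtain ⟨M, hM⟩ := isCompact_Icc.exists_bound_of_continuousOn (ha k hk)
      exact ⟨M, fun _ => hM⟩
    · exact ⟨0, fun h => absurd h hk⟩
  choose M hM using hb
  -- From `|v ^ k - u ^ k| ≤ k * R ^ (k - 1) * |v - u|`; at `k = 0` the factor `k` makes the
  -- truncated exponent harmless.
  refine ⟨Real.toNNReal (∑ k ∈ Finset.range (n + 1), M k * (k * R ^ (k - 1))), fun t ht =>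
    LipschitzOnWith.of_dist_le_mul fun u hu v hv => ?_⟩
  refine le_trans ?_ (mul_le_mul_of_nonneg_right (Real.le_coe_toNNReal _) dist_nonneg)
  rw [Real.dist_eq, Real.dist_eq, neg_sub_neg, ← Finset.sum_sub_distrib, Finset.sum_mul]
  refine (Finset.abs_sum_le_sum_abs _ _).trans (Finset.sum_le_sum fun k hk => ?_)
  have hk' : k ≤ n := by simpa [Nat.lt_succ_iff] using hk
  have huv : max |v| |u| ≤ R := max_le (abs_le.2 hv) (abs_le.2 hu)
  rw [← mul_sub, abs_mul, mul_assoc]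
  refine mul_le_mul (hM k hk' t ht) ((abs_pow_sub_pow_le v u k).trans ?_) (abs_nonneg _)
    ((abs_nonneg _).trans (hM k hk' t ht))
  have h0 : 0 ≤ max |v| |u| := (abs_nonneg _).trans (le_max_left _ _)
  have h1 : max |v| |u| ^ (k - 1) ≤ R ^ (k - 1) := by gcongr
  rw [abs_sub_comm v u, mul_comm _ |u - v|, mul_assoc]
  gcongr

theorem le_supIcc {g : ℝ → ℝ} {t₀ T : ℝ} (hg : ContinuousOn g (Icc t₀ T)) {t : ℝ}
    (ht : t ∈ Icc t₀ T) : g t ≤ supIcc g t₀ T :=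
  le_csSup (isCompact_Icc.image_of_continuousOn hg).bddAbove (mem_image_of_mem g ht)

theorem infIcc_le {g : ℝ → ℝ} {t₀ T : ℝ} (hg : ContinuousOn g (Icc t₀ T)) {t : ℝ}
    (ht : t ∈ Icc t₀ T) : infIcc g t₀ T ≤ g t :=
  csInf_le (isCompact_Icc.image_of_continuousOn hg).bddBelow (mem_image_of_mem g ht)

theorem supIcc_neg (g : ℝ → ℝ) (t₀ T : ℝ) :
    supIcc (fun t => -g t) t₀ T = -infIcc g t₀ T := by
  have : (fun t => -g t) '' Icc t₀ T = -(g '' Icc t₀ T) := by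
    rw [← image_neg_eq_neg, image_image]
  rw [supIcc, infIcc, this, Real.sInf_def, neg_neg]

/-- The `c k` need not be continuous; their boundedness is what makes `sSup` a genuine upper bound.
-/
theorem sum_abs_le_coeffBound {n : ℕ} {c : ℕ → ℝ → ℝ} {t₀ T : ℝ}
    (hc : ∀ k ∈ Finset.Icc 2 (n - 1), ∃ C : ℝ, ∀ t ∈ Icc t₀ T, |c k t| ≤ C)
    {t : ℝ} (ht : t ∈ Icc t₀ T) :
    ∑ k ∈ Finset.Icc 2 (n - 1), |c k t| ≤ coeffBound n c t₀ T := by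
  choose! C hC using hc
  refine le_trans (le_csSup ⟨∑ k ∈ Finset.Icc 2 (n - 1), C k, ?_⟩
    (mem_image_of_mem (fun t => ∑ k ∈ Finset.Icc 2 (n - 1), |c k t|) ht)) (le_max_right _ _)
  rintro _ ⟨s, hs, rfl⟩
  exact Finset.sum_le_sum fun k hk => hC k hk s hs

/-! ### The barriers as solutions of the linear equation. -/

section Barriers

variable {a : ℕ → ℝ → ℝ} {t₀ T : ℝ}

theorem hasDerivWithinAt_linPrim (h1 : ContinuousOn (a 1) (Icc t₀ T)) {t : ℝ}
    (ht : t ∈ Icc t₀ T) : HasDerivWithinAt (linPrim a t₀) (a 1 t) (Icc t₀ T) t :=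
  hasDerivWithinAt_integral_Icc h1 ht

theorem continuousOn_linPrim (h1 : ContinuousOn (a 1) (Icc t₀ T)) :
    ContinuousOn (linPrim a t₀) (Icc t₀ T) :=
  fun _ ht => (hasDerivWithinAt_linPrim h1 ht).continuousWithinAt

theorem hasDerivWithinAt_forcingPrim (h0 : ContinuousOn (a 0) (Icc t₀ T))
    (h1 : ContinuousOn (a 1) (Icc t₀ T)) {t : ℝ} (ht : t ∈ Icc t₀ T) :
    HasDerivWithinAt (forcingPrim a t₀) (Real.exp (linPrim a t₀ t) * a 0 t) (Icc t₀ T) t :=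
  hasDerivWithinAt_integral_Icc ((continuousOn_linPrim h1).rexp.mul h0) ht

theorem continuousOn_forcingPrim (h0 : ContinuousOn (a 0) (Icc t₀ T))
    (h1 : ContinuousOn (a 1) (Icc t₀ T)) : ContinuousOn (forcingPrim a t₀) (Icc t₀ T) :=
  fun _ ht => (hasDerivWithinAt_forcingPrim h0 h1 ht).continuousWithinAt

/-- The functions `e^{-A} (C - J)` solve the linear equation `y' + a₁ y + a₀ = 0`. -/
theorem hasDerivWithinAt_exp_neg_mul (h0 : ContinuousOn (a 0) (Icc t₀ T))
    (h1 : ContinuousOn (a 1) (Icc t₀ T)) (C : ℝ) {t : ℝ} (ht : t ∈ Icc t₀ T) :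
    HasDerivWithinAt (fun s => Real.exp (-linPrim a t₀ s) * (C - forcingPrim a t₀ s))
      (-(a 0 t + a 1 t * (Real.exp (-linPrim a t₀ t) * (C - forcingPrim a t₀ t))))
      (Icc t₀ T) t := by
  refine ((hasDerivWithinAt_linPrim h1 ht).fun_neg.exp.fun_mul
    ((hasDerivWithinAt_forcingPrim h0 h1 ht).const_sub C)).congr_deriv ?_
  have : Real.exp (-linPrim a t₀ t) * Real.exp (linPrim a t₀ t) = 1 := by
    rw [← Real.exp_add]; simp
  linear_combination (-a 0 t) * this

theorem upperBarrier_eq (γ t : ℝ) :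
    upperBarrier a γ t₀ T t = Real.exp (-linPrim a t₀ t) *
      (γ * Real.exp (supIcc (linPrim a t₀) t₀ T) + supIcc (forcingPrim a t₀) t₀ T
        - forcingPrim a t₀ t) := by
  rw [upperBarrier, sub_eq_add_neg (supIcc (linPrim a t₀) t₀ T), Real.exp_add]
  ring

theorem lowerBarrier_eq (γ t : ℝ) :
    lowerBarrier a γ t₀ T t = Real.exp (-linPrim a t₀ t) *
      (-(γ * Real.exp (supIcc (linPrim a t₀) t₀ T)) + infIcc (forcingPrim a t₀) t₀ T
        - forcingPrim a t₀ t) := by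
  rw [lowerBarrier, supIcc_neg, sub_eq_add_neg (supIcc (linPrim a t₀) t₀ T), Real.exp_add]
  ring

theorem le_upperBarrier (h0 : ContinuousOn (a 0) (Icc t₀ T)) (h1 : ContinuousOn (a 1) (Icc t₀ T))
    {γ : ℝ} (hγ : 0 ≤ γ) {t : ℝ} (ht : t ∈ Icc t₀ T) : γ ≤ upperBarrier a γ t₀ T t := by
  have hA := le_supIcc (continuousOn_linPrim h1) ht
  have hJ := le_supIcc (continuousOn_forcingPrim h0 h1) ht
  have h2 := mul_le_mul_of_nonneg_left (Real.one_le_exp (sub_nonneg.2 hA)) hγ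
  have h3 := mul_nonneg (Real.exp_nonneg (-linPrim a t₀ t)) (sub_nonneg.2 hJ)
  rw [upperBarrier]
  linarith

theorem lowerBarrier_le_neg (h0 : ContinuousOn (a 0) (Icc t₀ T))
    (h1 : ContinuousOn (a 1) (Icc t₀ T)) {γ : ℝ} (hγ : 0 ≤ γ) {t : ℝ} (ht : t ∈ Icc t₀ T) :
    lowerBarrier a γ t₀ T t ≤ -γ := by
  have hA := le_supIcc (continuousOn_linPrim h1) ht
  have hJ := infIcc_le (continuousOn_forcingPrim h0 h1) ht
  have h2 := mul_le_mul_of_nonneg_left (Real.one_le_exp (sub_nonneg.2 hA)) hγ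
  have h3 := mul_nonneg (Real.exp_nonneg (-linPrim a t₀ t)) (sub_nonneg.2 hJ)
  rw [lowerBarrier, supIcc_neg]
  linarith

theorem hasDerivWithinAt_upperBarrier (h0 : ContinuousOn (a 0) (Icc t₀ T))
    (h1 : ContinuousOn (a 1) (Icc t₀ T)) (γ : ℝ) {t : ℝ} (ht : t ∈ Icc t₀ T) :
    HasDerivWithinAt (upperBarrier a γ t₀ T) (-(a 0 t + a 1 t * upperBarrier a γ t₀ T t))
      (Icc t₀ T) t := by
  rw [funext (upperBarrier_eq (a := a) (t₀ := t₀) (T := T) γ)]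
  exact hasDerivWithinAt_exp_neg_mul h0 h1 _ ht

theorem hasDerivWithinAt_lowerBarrier (h0 : ContinuousOn (a 0) (Icc t₀ T))
    (h1 : ContinuousOn (a 1) (Icc t₀ T)) (γ : ℝ) {t : ℝ} (ht : t ∈ Icc t₀ T) :
    HasDerivWithinAt (lowerBarrier a γ t₀ T) (-(a 0 t + a 1 t * lowerBarrier a γ t₀ T t))
      (Icc t₀ T) t := by
  rw [funext (lowerBarrier_eq (a := a) (t₀ := t₀) (T := T) γ)]
  exact hasDerivWithinAt_exp_neg_mul h0 h1 _ ht

theorem linPrim_self : linPrim a t₀ t₀ = 0 := intervalIntegral.integral_same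

theorem forcingPrim_self : forcingPrim a t₀ t₀ = 0 := intervalIntegral.integral_same

/-- After multiplication by `e^{A(T)}`, the claim is `hmax` plus the nonnegative term `γ e^{max A}
(e^{A(T)} - 1)`. -/
theorem upperBarrier_right_le_left {γ : ℝ} (hγ : 0 ≤ γ) (hA : 0 ≤ linPrim a t₀ T)
    (hmax : supIcc (forcingPrim a t₀) t₀ T * (1 - Real.exp (linPrim a t₀ T)) ≤ forcingPrim a t₀ T) :
    upperBarrier a γ t₀ T T ≤ upperBarrier a γ t₀ T t₀ := by
  rw [upperBarrier_eq, upperBarrier_eq, linPrim_self, forcingPrim_self, neg_zero, Real.exp_zero,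
    one_mul, Real.exp_neg, inv_mul_le_iff₀ (Real.exp_pos _)]
  have := mul_nonneg (mul_nonneg hγ (Real.exp_nonneg (supIcc (linPrim a t₀) t₀ T)))
    (sub_nonneg.2 (Real.one_le_exp hA))
  linarith

theorem lowerBarrier_left_le_right {γ : ℝ} (hγ : 0 ≤ γ) (hA : 0 ≤ linPrim a t₀ T)
    (hmin : forcingPrim a t₀ T ≤ infIcc (forcingPrim a t₀) t₀ T * (1 - Real.exp (linPrim a t₀ T))) :
    lowerBarrier a γ t₀ T t₀ ≤ lowerBarrier a γ t₀ T T := by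
  rw [lowerBarrier_eq, lowerBarrier_eq, linPrim_self, forcingPrim_self, neg_zero, Real.exp_zero,
    one_mul, Real.exp_neg, le_inv_mul_iff₀ (Real.exp_pos _)]
  have := mul_nonneg (mul_nonneg hγ (Real.exp_nonneg (supIcc (linPrim a t₀) t₀ T)))
    (sub_nonneg.2 (Real.one_le_exp hA))
  linarith

/-- If `A(T) < 0`, the two-sided condition on `J` forces the forcing term to vanish. -/
theorem forcing_eq_zero_of_linPrim_neg (hT : t₀ < T) (h0 : ContinuousOn (a 0) (Icc t₀ T))
    (h1 : ContinuousOn (a 1) (Icc t₀ T)) (hA : linPrim a t₀ T < 0)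
    (h : supIcc (forcingPrim a t₀) t₀ T * (1 - Real.exp (linPrim a t₀ T))
      ≤ infIcc (forcingPrim a t₀) t₀ T * (1 - Real.exp (linPrim a t₀ T)))
    {t : ℝ} (ht : t ∈ Icc t₀ T) : a 0 t = 0 := by
  have hle := le_of_mul_le_mul_right h (sub_pos.2 (Real.exp_lt_one_iff.2 hA))
  have hJc := continuousOn_forcingPrim h0 h1
  have hmem : t₀ ∈ Icc t₀ T := left_mem_Icc.2 hT.le
  -- `J` is constant because `max J ≤ min J`, and `J(t₀) = 0`.
  have hJ : ∀ s ∈ Icc t₀ T, forcingPrim a t₀ s = 0 := fun s hs => by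
    have h2 := le_supIcc hJc hs
    have h3 := infIcc_le hJc hs
    have h4 := le_supIcc hJc hmem
    have h5 := infIcc_le hJc hmem
    rw [forcingPrim_self] at h4 h5
    linarith
  have hd := (hasDerivWithinAt_forcingPrim h0 h1 ht).congr_of_mem (f₁ := fun _ => 0)
    (fun s hs => (hJ s hs).symm) ht
  have := (uniqueDiffOn_Icc hT t ht).eq_deriv _ hd (hasDerivWithinAt_const t _ (0 : ℝ))
  exact (mul_eq_zero.1 this).resolve_left (Real.exp_pos _).ne'

end Barriers

/-! ### The closed solution, by the sign of `A(T)`. -/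

theorem theorem5p5 (n : ℕ) (hn : Odd n) (t₀ T : ℝ) (hT : t₀ < T)
    (a c d : ℕ → ℝ → ℝ)
    (ha : ∀ k ≤ n, ContinuousOn (a k) (Icc t₀ T))
    (han : ∀ t ∈ Icc t₀ T, 0 ≤ a n t)
    (hdec : ∀ k ∈ Finset.Icc 2 (n - 1), ∀ t ∈ Icc t₀ T, a k t = a n t * c k t + d k t)
    (hc : ∀ k ∈ Finset.Icc 2 (n - 1), ∃ C : ℝ, ∀ t ∈ Icc t₀ T, |c k t| ≤ C)
    (hd_pos : ∀ u : ℝ, coeffBound n c t₀ T ≤ u → ∀ t ∈ Icc t₀ T,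
      0 ≤ ∑ k ∈ Finset.Icc 2 (n - 1), d k t * u ^ k)
    (hd_neg : ∀ u : ℝ, coeffBound n c t₀ T ≤ u → ∀ t ∈ Icc t₀ T,
      0 ≤ ∑ k ∈ Finset.Icc 2 (n - 1), (-1 : ℝ) ^ (k + 1) * d k t * u ^ k)
    (hmax : supIcc (forcingPrim a t₀) t₀ T * (1 - Real.exp (linPrim a t₀ T))
      ≤ forcingPrim a t₀ T)
    (hmin : forcingPrim a t₀ T
      ≤ infIcc (forcingPrim a t₀) t₀ T * (1 - Real.exp (linPrim a t₀ T))) :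
    ∃ y : ℝ → ℝ, IsClosedPolySolution n a t₀ T y ∧
      ∀ t ∈ Icc t₀ T,
        lowerBarrier a (coeffBound n c t₀ T) t₀ T t ≤ y t ∧
        y t ≤ upperBarrier a (coeffBound n c t₀ T) t₀ T t := by
  have h0 := ha 0 (Nat.zero_le n)
  have h1 := ha 1 hn.pos
  set N := coeffBound n c t₀ T
  have hN1 : 1 ≤ N := le_max_left _ _
  have hN0 : 0 ≤ N := zero_le_one.trans hN1
  rcases lt_or_ge (linPrim a t₀ T) 0 with hA | hA
  · refine ⟨fun _ => 0, ⟨fun t ht => ?_, rfl⟩, fun t ht =>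
      ⟨(lowerBarrier_le_neg h0 h1 hN0 ht).trans (neg_nonpos.2 hN0),
        hN0.trans (le_upperBarrier h0 h1 hN0 ht)⟩⟩
    have hz : ∑ k ∈ Finset.range (n + 1), a k t * (0 : ℝ) ^ k = 0 := by
      refine Finset.sum_eq_zero fun k _ => ?_
      rcases eq_or_ne k 0 with rfl | hk
      · rw [forcing_eq_zero_of_linPrim_neg hT h0 h1 hA (hmax.trans hmin) ht, zero_mul]
      · rw [zero_pow hk, mul_zero]
    rw [hz, neg_zero]
    exact hasDerivWithinAt_const _ _ _
  · have hcont : ContinuousOn (Function.uncurry fun t u : ℝ =>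
        -∑ k ∈ Finset.range (n + 1), a k t * u ^ k) (Icc t₀ T ×ˢ univ) := by
      refine ContinuousOn.neg (continuousOn_finsetSum _ fun k hk => ?_)
      refine ContinuousOn.mul ((ha k ?_).comp continuousOn_fst fun p hp => hp.1)
        (continuousOn_snd.pow k)
      simpa [Nat.lt_succ_iff] using hk
    obtain ⟨y, hy, hy0, hyb⟩ := exists_closed_solution_between hT hcont
      (exists_lipschitzOnWith_poly ha)
      (fun t ht => hasDerivWithinAt_lowerBarrier h0 h1 N ht)
      (fun t ht => hasDerivWithinAt_upperBarrier h0 h1 N ht)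
      (fun t ht => by
        have hle := lowerBarrier_le_neg h0 h1 hN0 ht
        have := sum_le_affine_of_le hn (a := fun k => a k t) (c := fun k => c k t)
          (d := fun k => d k t) (u := -lowerBarrier a N t₀ T t) (by linarith)
          ((sum_abs_le_coeffBound hc ht).trans (by linarith)) (han t ht)
          (fun k hk => hdec k hk t ht) (hd_neg _ (by linarith) t ht)
        rw [neg_neg] at this
        exact neg_le_neg this)
      (fun t ht => by
        have hle := le_upperBarrier h0 h1 hN0 ht
        exact neg_le_neg (affine_le_sum_of_le hn (a := fun k => a k t) (c := fun k => c k t)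
          (d := fun k => d k t) (hN1.trans hle)
          ((sum_abs_le_coeffBound hc ht).trans hle) (han t ht)
          (fun k hk => hdec k hk t ht) (hd_pos _ hle t ht)))
      (fun t ht => by
        have := lowerBarrier_le_neg h0 h1 hN0 ht
        have := le_upperBarrier h0 h1 hN0 ht
        linarith)
      (lowerBarrier_left_le_right hN0 hA hmin) (upperBarrier_right_le_left hN0 hA hmax)
    exact ⟨y, ⟨hy, hy0⟩, hyb⟩
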